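/- Let $k$ be an algebraically closed field (of any characteristic) and $S=k[z_0,z_1,\dots]$ with the standard grading. For $d\ge 1$ let $\mathbf S_d$ be the space of forms of degree $d$ in $S$ (including $0$), with the direct limit topology: a subset is closed if and only if, for every $n$, its intersection with the finite-dimensional affine space of degree $d$ forms in $k[z_0,\dots,z_n]$ is Zariski closed. The strength of $f\in S$ is the least $s\ge 0$ for which $f=\sum_{i=0}^s g_ih_i$ with all $g_i,h_i$ homogeneous of positive degree ($0$ being homogeneous of every degree), or $\infty$ if there is no such expression. The collective strength of forms $f_1,\dots,f_r$ is the least strength of a nontrivial homogeneous $k$-linear combination of $f_1,\dots,f_r$. If a form $f$ has finite strength $s$, its secondary strength is the largest collective strength (possibly $\infty$) of $g_0,\dots,g_s,h_0,\dots,h_s$ over all expressions $f=\sum_{i=0}^s g_ih_i$ with all $g_i,h_i$ homogeneous of positive degree. Let $d\ge 2$, $s\ge 0$, and let $\mu=(\mu_0,\dots,\mu_s)$ be integers with $1\le\mu_0\le\mu_1\le\dots\le\mu_s\le\lfloor d/2\rfloor$. Let $\mathbf S_{d,\mu}\subseteq\mathbf S_d$ be the set of all $f=\sum_{i=0}^s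 g_ih_i$ with $g_i\in\mathbf S_{\mu_i}$ and $h_i\in\mathbf S_{d-\mu_i}$, with the subspace topology. Then for every integer $N\ge 0$, the set of those $f\in\mathbf S_{d,\mu}$ whose secondary strength is at least $N$ contains a dense open subset of $\mathbf S_{d,\mu}$. -/

import Mathlib

namespace StrengthTheory

/-! ### The Zariski topology and the space of forms of degree `d` in infinitely many variables -/

/-- The polynomial functions on a vector space `V`: the `k`-algebra of functions `V → k` generated
by the linear functionals (the coordinate ring of the affine space `V` if `V` is
finite-dimensional and `k` is infinite). -/
def polynomialFunctions (k V : Type*) [Field k] [AddCommGroup V] [Module k V] :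
    Subalgebra k (V → k) :=
  Algebra.adjoin k (Set.range fun φ : Module.Dual k V => (φ : V → k))

/-- The Zariski topology on an affine space `V`: the closed sets are the common zero loci of
arbitrary sets of polynomial functions. -/
@[reducible] def zariskiTopology (k V : Type*) [Field k] [AddCommGroup V] [Module k V] :
    TopologicalSpace V :=
  TopologicalSpace.ofClosed
    {Z : Set V | ∃ I : Set (V → k), I ⊆ (polynomialFunctions k V : Set (V → k)) ∧
      Z = {v | ∀ p ∈ I, p v = 0}}
    (by
      refine ⟨{1}, ?_, ?_⟩
      · rintro p rfl
        exact one_mem _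
      · ext v
        simp)
    (by
      intro A hA
      refine ⟨{p | p ∈ polynomialFunctions k V ∧ ∃ Z ∈ A, ∀ v ∈ Z, p v = 0},
        fun p hp => hp.1, ?_⟩
      ext v
      constructor
      · rintro hv p ⟨-, Z, hZ, hp⟩
        exact hp v (hv Z hZ)
      · intro hv Z hZ
        obtain ⟨I, hI, hZI⟩ := hA hZ
        rw [hZI]
        intro p hp
        refine hv p ⟨hI hp, Z, hZ, fun w hw => ?_⟩
        rw [hZI] at hw
        exact hw p hp)
    (by
      rintro _ ⟨I, hI, rfl⟩ _ ⟨J, hJ, rfl⟩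
      refine ⟨{r | ∃ p ∈ I, ∃ q ∈ J, r = p * q}, ?_, ?_⟩
      · rintro _ ⟨p, hp, q, hq, rfl⟩
        exact mul_mem (hI hp) (hJ hq)
      · ext v
        constructor
        · rintro (hv | hv) _ ⟨p, hp, q, hq, rfl⟩
          · simp [hv p hp]
          · simp [hv q hq]
        · intro hv
          by_contra hcon
          simp only [Set.mem_union, Set.mem_ofPred_eq, not_or, not_forall] at hcon
          obtain ⟨⟨p, hp, hpv⟩, q, hq, hqv⟩ := hcon
          have h := hv (p * q) ⟨p, hp, q, hq, rfl⟩
          exact (mul_ne_zero hpv hqv) h)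

/-- The forms of degree `d` in `k[z_0, z_1, …]` (including `0`). -/
abbrev Forms (k : Type*) [Field k] (d : ℕ) : Type _ :=
  ↥(MvPolynomial.homogeneousSubmodule ℕ k d)

/-- The forms of degree `d` in `k[z_0, …, z_n]` (including `0`), a finite-dimensional space. -/
abbrev FiniteForms (k : Type*) [Field k] (n d : ℕ) : Type _ :=
  ↥(MvPolynomial.homogeneousSubmodule (Fin (n + 1)) k d)

/-- The inclusion of the forms in `k[z_0, …, z_n]` into the forms in `k[z_0, z_1, …]`. -/
noncomputable def finiteFormsInclusion (k : Type*) [Field k] (n d : ℕ) (f : FiniteForms k n d) :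
    Forms k d :=
  ⟨MvPolynomial.rename (Fin.val : Fin (n + 1) → ℕ) (f : MvPolynomial (Fin (n + 1)) k),
    MvPolynomial.IsHomogeneous.rename_isHomogeneous
      ((MvPolynomial.mem_homogeneousSubmodule _ _).1 f.2)⟩

/-- The direct limit topology on the forms of degree `d`: a set is open (closed) iff for every `n`
its preimage in the affine space of forms in `k[z_0, …, z_n]` is Zariski open (closed). -/
noncomputable instance formsTopology (k : Type*) [Field k] (d : ℕ) : TopologicalSpace (Forms k d) :=
  ⨆ n : ℕ, (zariskiTopology k (FiniteForms k n d)).coinduced (finiteFormsInclusion k n d)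

/-! ### Strength, collective strength, secondary strength -/

/-- `f = ∑ i, g i * h i` with all `g i`, `h i` homogeneous of positive degree (the polynomial `0`
counts as homogeneous of every degree). -/
def IsStrengthDecomposition {k : Type*} [Field k] {s : ℕ} (f : MvPolynomial ℕ k)
    (g h : Fin (s + 1) → MvPolynomial ℕ k) : Prop :=
  (∀ i, ∃ a : ℕ, 1 ≤ a ∧ (g i).IsHomogeneous a) ∧
  (∀ i, ∃ b : ℕ, 1 ≤ b ∧ (h i).IsHomogeneous b) ∧
  f = ∑ i, g i * h i

/-- The strength of `f`: the least `s` such that `f = ∑_{i=0}^s g_i h_i` with `g_i`, `h_i`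
homogeneous of positive degree, and `⊤` if there is no such expression. -/
noncomputable def strength {k : Type*} [Field k] (f : MvPolynomial ℕ k) : ℕ∞ :=
  ⨅ (s : ℕ) (_ : ∃ g h : Fin (s + 1) → MvPolynomial ℕ k, IsStrengthDecomposition f g h), (s : ℕ∞)

/-- The collective strength of a finite tuple of forms: the least strength of a nontrivial
homogeneous `k`-linear combination. -/
noncomputable def collectiveStrength {k : Type*} [Field k] {ι : Type*} [Fintype ι]
    (f : ι → MvPolynomial ℕ k) : ℕ∞ :=
  ⨅ (c : ι → k) (_ : c ≠ 0) (_ : ∃ e : ℕ, (∑ i, c i • f i).IsHomogeneous e),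
    strength (∑ i, c i • f i)

/-- The secondary strength of a form `f` of strength `s`: the largest collective strength of
`g_0, …, g_s, h_0, …, h_s` over all decompositions `f = ∑_{i=0}^s g_i h_i`
(it may be infinite). -/
noncomputable def secondaryStrength {k : Type*} [Field k] (f : MvPolynomial ℕ k) : ℕ∞ :=
  ⨆ (s : ℕ) (_ : strength f = (s : ℕ∞)) (g : Fin (s + 1) → MvPolynomial ℕ k)
    (h : Fin (s + 1) → MvPolynomial ℕ k) (_ : IsStrengthDecomposition f g h),
    collectiveStrength (Sum.elim g h)

/-- The forms of degree `d` that admit a strength decomposition of type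
`μ = (μ_0, …, μ_s)`: those of the shape `∑_{i=0}^s g_i h_i` with `g_i` a form of degree `μ_i` and
`h_i` a form of degree `d - μ_i`. -/
def strengthStratum (k : Type*) [Field k] (d : ℕ) {s : ℕ} (μ : Fin (s + 1) → ℕ) :
    Set (Forms k d) :=
  {f | ∃ g h : Fin (s + 1) → MvPolynomial ℕ k,
    (∀ i, (g i).IsHomogeneous (μ i)) ∧ (∀ i, (h i).IsHomogeneous (d - μ i)) ∧
    (f : MvPolynomial ℕ k) = ∑ i, g i * h i}

end StrengthTheory

/-! Let `f = ∑ g i * h i` with `m = s + 1` terms. At a common zero of the `2m` factors, the product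
rule turns the Hessian of `f` into the transposed Jacobian of the factors times the same Jacobian
with the rows of `g` and `h` swapped. Hence a minor of size `2m`, with the same variables for rows
and columns, is up to sign the square of a minor of the Jacobian (`det_hessian`); nothing is divided
by 2, so the characteristic plays no role. If a nontrivial combination of the factors is a sum of
`n` products, the Jacobian drops rank wherever all `2m + 2n` forms vanish, and by Krull's height
theorem they have a common nonzero zero on any coordinate subspace of larger dimension
(`exists_nonzero_common_zero`).

So it suffices that `M + 1` chosen minors of the Hessian, with `2m + 2n ≤ M`, have no common nonzero
zero on a coordinate subspace of dimension `M + 1`; this bounds every decomposition of `f` at once.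
An elimination determinant, `discriminant`, guarantees this wherever it is nonzero, which is an open
condition. It is nonzero at an explicit form of the stratum (`discriminant_ne_zero`), and a rational
curve inside the stratum joins that form to any other element, which gives density
(`dense_of_polynomial_ne_zero`). -/

namespace StrengthTheory

open MvPolynomial

/-! ### Common zeros of few polynomials -/

/-- The ideal of the coordinate subspace `z_j = 0` for `j < i`. -/
noncomputable def coordinatePrime (k : Type*) [Field k] (M : ℕ) (i : ℕ) :
    PrimeSpectrum (MvPolynomial (Fin M) k) :=
  ⟨RingHom.ker (aeval (R := k) fun j : Fin M =>
    if (j : ℕ) < i then (0 : MvPolynomial (Fin M) k) else X j), RingHom.ker_isPrime _⟩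

/-- Supplies the chain of primes of length `M` that bounds the height of the ideal of the origin
from below. -/
theorem coordinatePrime_lt (k : Type*) [Field k] {M i : ℕ} (hi : i < M) :
    coordinatePrime k M i < coordinatePrime k M (i + 1) := by
  rw [← PrimeSpectrum.asIdeal_lt_asIdeal, lt_iff_le_not_ge]
  constructor
  · intro p hp
    have hcomp : (aeval (R := k) fun j : Fin M =>
        if (j : ℕ) < i + 1 then (0 : MvPolynomial (Fin M) k) else X j) =
        (aeval (R := k) fun j : Fin M =>
          if (j : ℕ) < i + 1 then (0 : MvPolynomial (Fin M) k) else X j).comp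
        (aeval (R := k) fun j : Fin M =>
          if (j : ℕ) < i then (0 : MvPolynomial (Fin M) k) else X j) := by
      ext1 j
      simp only [AlgHom.comp_apply, aeval_X]
      by_cases h : (j : ℕ) < i
      · simp [h, Nat.lt_succ_of_lt h]
      · simp [h]
    have hp' := RingHom.mem_ker.1 hp
    refine RingHom.mem_ker.2 ?_
    rw [hcomp, AlgHom.comp_apply, hp', map_zero]
  · intro h
    have h1 : (X ⟨i, hi⟩ : MvPolynomial (Fin M) k) ∈ (coordinatePrime k M (i + 1)).asIdeal :=
      RingHom.mem_ker.2 (by simp)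
    have h2 := RingHom.mem_ker.1 (h h1)
    simp at h2

/-- If the origin were the only zero, the Nullstellensatz would make its maximal ideal the radical
of `I`, hence minimal over `I`. Its height would be at most the number of generators, yet the
coordinate primes show that it is at least `M`. -/
theorem exists_nonzero_common_zero {k : Type*} [Field k] [IsAlgClosed k] {M : ℕ} {ι : Type*}
    [Fintype ι] (hM : Fintype.card ι < M) (F : ι → MvPolynomial (Fin M) k)
    (hF : ∀ i, eval 0 (F i) = 0) : ∃ x : Fin M → k, x ≠ 0 ∧ ∀ i, eval x (F i) = 0 := by
  classical
  by_contra! hcon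
  set I : Ideal (MvPolynomial (Fin M) k) := Ideal.span (Set.range F) with hI
  have hzero : zeroLocus k I = {0} := by
    ext x
    rw [hI, zeroLocus_span]
    simp only [Set.mem_range, forall_exists_index, forall_apply_eq_imp_iff, Set.mem_ofPred_eq,
      Set.mem_singleton_iff]
    constructor
    · intro h
      by_contra hx
      obtain ⟨i, hi⟩ := hcon x hx
      exact hi (h i)
    · rintro rfl i
      exact hF i
  have hrad : I.radical = vanishingIdeal k {(0 : Fin M → k)} := by
    rw [← vanishingIdeal_zeroLocus_eq_radical (K := k), hzero]
  have hker : (coordinatePrime k M M).asIdeal ≤ I.radical := by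
    intro p hp
    rw [hrad, mem_vanishingIdeal_singleton_iff]
    have hp' := RingHom.mem_ker.1 hp
    have hcomp : (aeval (R := k) fun j : Fin M =>
        if (j : ℕ) < M then (0 : MvPolynomial (Fin M) k) else X j) p = C (eval 0 p) := by
      simp only [Fin.is_lt, if_true]
      have : (aeval (R := k) fun _ : Fin M => (0 : MvPolynomial (Fin M) k)) =
          (Algebra.ofId k (MvPolynomial (Fin M) k)).comp (aeval (R := k) (0 : Fin M → k)) := by
        ext1 j
        simp
      exact DFunLike.congr_fun this p
    rw [hcomp] at hp'
    simpa using hp'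
  have hmax : I.radical.IsMaximal := by
    rw [hrad]; infer_instance
  have hmin : I.radical ∈ I.minimalPrimes := by
    refine ⟨⟨hmax.isPrime, Ideal.le_radical⟩, fun q hq _ => ?_⟩
    exact hq.1.radical_le_iff.2 hq.2
  have hle := Ideal.height_le_card_of_mem_minimalPrimes_span (Set.finite_range F) hmin
  have hcard : (Set.range F).ncard ≤ Fintype.card ι := by
    rw [← Set.image_univ, ← Nat.card_eq_fintype_card, ← Set.ncard_univ]
    exact Set.ncard_image_le
  have hlast : coordinatePrime k M M ≤ ⟨I.radical, hmax.isPrime⟩ := hker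
  let p : LTSeries (PrimeSpectrum (MvPolynomial (Fin M) k)) :=
    { length := M
      toFun := fun i => coordinatePrime k M i
      step := fun i => coordinatePrime_lt k i.2 }
  have hlen := Order.length_le_height (p := p) (x := ⟨I.radical, hmax.isPrime⟩) (by
    simpa [p, RelSeries.last] using hlast)
  rw [← PrimeSpectrum.height_eq_orderHeight] at hlen
  have := hlen.trans hle
  simp only [p] at this
  norm_cast at this
  omega

/-! ### Second derivatives of a sum of products at a common zero of the factors -/

/-- Terms containing a second derivative of one factor also contain the other factor
undifferentiated, and `φ` kills that one. Only products of first derivatives survive. -/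
theorem hessian_eq_mul {k R σ ι : Type*} [CommRing k] [CommRing R] {m : ℕ}
    (φ : MvPolynomial σ k →+* R) (p : Fin m ⊕ Fin m → MvPolynomial σ k) (hp : ∀ i, φ (p i) = 0)
    (y : ι → σ) :
    (Matrix.of fun a b : ι =>
      φ (pderiv (y a) (pderiv (y b) (∑ i, p (Sum.inl i) * p (Sum.inr i))))) =
    (Matrix.of fun (i : Fin m ⊕ Fin m) (a : ι) => φ (pderiv (y a) (p i))).transpose *
      (Matrix.of fun (i : Fin m ⊕ Fin m) (a : ι) => φ (pderiv (y a) (p i))).submatrix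
        (Equiv.sumComm _ _) id := by
  ext a b
  simp only [Matrix.of_apply, Matrix.mul_apply, Matrix.transpose_apply, Matrix.submatrix_apply,
    Fintype.sum_sum_type, Equiv.sumComm_apply, Sum.swap_inl, Sum.swap_inr, id_eq, map_sum,
    Derivation.leibniz, map_add, smul_eq_mul, map_mul, hp, zero_mul, zero_add]
  rw [← Finset.sum_add_distrib]
  exact Finset.sum_congr rfl fun i _ => by ring

theorem det_hessian {k R σ : Type*} [CommRing k] [CommRing R] {m : ℕ}
    (φ : MvPolynomial σ k →+* R) (p : Fin m ⊕ Fin m → MvPolynomial σ k) (hp : ∀ i, φ (p i) = 0)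
    (y : Fin m ⊕ Fin m → σ) :
    (Matrix.of fun a b : Fin m ⊕ Fin m =>
      φ (pderiv (y a) (pderiv (y b) (∑ i, p (Sum.inl i) * p (Sum.inr i))))).det =
    ((Equiv.Perm.sign (Equiv.sumComm (Fin m) (Fin m)) : ℤˣ) : ℤ) *
      (Matrix.of fun i a : Fin m ⊕ Fin m => φ (pderiv (y a) (p i))).det ^ 2 := by
  rw [hessian_eq_mul φ p hp y, Matrix.det_mul, Matrix.det_transpose, Matrix.det_permute]
  ring

/-- If the factors are linearly dependent up to a sum of products, the second derivatives are
degenerate at the common zeros of all the forms involved. -/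
theorem det_hessian_eq_zero {k R σ l : Type*} [Field k] [CommRing R] [IsDomain R] [Algebra k R]
    [Fintype l] {m : ℕ} (φ : MvPolynomial σ k →ₐ[k] R)
    (p : Fin m ⊕ Fin m → MvPolynomial σ k) (hp : ∀ i, φ (p i) = 0) (c : Fin m ⊕ Fin m → k)
    (hc : c ≠ 0) (u v : l → MvPolynomial σ k) (hu : ∀ i, φ (u i) = 0) (hv : ∀ i, φ (v i) = 0)
    (h : ∑ i, c i • p i = ∑ i, u i * v i) (y : Fin m ⊕ Fin m → σ) :
    (Matrix.of fun a b : Fin m ⊕ Fin m =>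
      φ (pderiv (y a) (pderiv (y b) (∑ i, p (Sum.inl i) * p (Sum.inr i))))).det = 0 := by
  have key := det_hessian (φ : MvPolynomial σ k →+* R) p hp y
  have hB : (Matrix.of fun i a : Fin m ⊕ Fin m => φ (pderiv (y a) (p i))).det = 0 := by
    -- Differentiating the relation kills its right-hand side under `φ`, since each term keeps some
    -- `u i` or `v i`; so `c` is a left null vector of the Jacobian.
    refine Matrix.exists_vecMul_eq_zero_iff.1 ⟨fun i => algebraMap k R (c i), ?_, ?_⟩
    · intro h0
      refine hc (funext fun i => ?_)
      exact (map_eq_zero_iff _ (FaithfulSMul.algebraMap_injective k R)).1 (congrFun h0 i)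
    · ext a
      have := congrArg (fun q => φ (pderiv (y a) q)) h
      simp only [map_sum, Derivation.leibniz, map_add, smul_eq_mul, map_mul, hu, hv,
        zero_mul, add_zero, Finset.sum_const_zero] at this
      simpa [Matrix.vecMul, dotProduct, Algebra.smul_def] using this
  simp only [RingHom.coe_coe] at key
  rw [key, hB]
  simp

/-! ### Elimination -/

/-- A variable whose exponent in `m` is at least `D`, if there is one. -/
noncomputable def pivot {σ : Type*} [Nonempty σ] (D : ℕ) (m : σ →₀ ℕ) : σ :=
  Classical.epsilon fun j => D ≤ m j

theorem le_pivot {σ : Type*} [Nonempty σ] [Fintype σ] {D T : ℕ} (hT : Fintype.card σ * D < T)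
    (m : σ →₀ ℕ) (hm : ∑ j, m j = T) : D ≤ m (pivot D m) := by
  refine Classical.epsilon_spec (p := fun j => D ≤ m j) ?_
  by_contra! h
  have : ∑ j, m j ≤ ∑ _j : σ, D := Finset.sum_le_sum fun j _ => (h j).le
  simp only [Finset.sum_const, Finset.card_univ, smul_eq_mul] at this
  omega

/-- The matrix expressing the multiples `z^(m - D e_j) F_j`, where `j` is the pivot of `m`, of forms
`F_j` of degree `D` in terms of the monomials of degree `T`. -/
noncomputable def eliminationMatrix {σ k : Type*} [Fintype σ] [DecidableEq σ] [Nonempty σ] [Field k]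
    (D T : ℕ) (F : σ → MvPolynomial σ k) :
    Matrix ↥((Finset.univ : Finset σ).finsuppAntidiag T)
      ↥((Finset.univ : Finset σ).finsuppAntidiag T) k :=
  Matrix.of fun m m' => coeff (m' : σ →₀ ℕ)
    (monomial ((m : σ →₀ ℕ) - Finsupp.single (pivot D (m : σ →₀ ℕ)) D) 1 *
      F (pivot D (m : σ →₀ ℕ)))

theorem sum_eq_of_mem_finsuppAntidiag {σ : Type*} [Fintype σ] [DecidableEq σ] {T : ℕ}
    (m : ↥((Finset.univ : Finset σ).finsuppAntidiag T)) : ∑ j, (m : σ →₀ ℕ) j = T :=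
  (Finset.mem_finsuppAntidiag.1 m.2).1

/-- At a common zero `x` the matrix kills the vector of all monomials of degree `T` evaluated at
`x`. If it is invertible, these values vanish, in particular the pure powers `x j ^ T`. -/
theorem eq_zero_of_det_eliminationMatrix_ne_zero {σ k : Type*} [Fintype σ] [DecidableEq σ]
    [Nonempty σ] [Field k] {D T : ℕ} (hT : Fintype.card σ * D < T) (F : σ → MvPolynomial σ k)
    (hF : ∀ j, (F j).IsHomogeneous D) (hdet : (eliminationMatrix D T F).det ≠ 0) (x : σ → k)
    (hx : ∀ j, eval x (F j) = 0) : x = 0 := by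
  have hker : (eliminationMatrix D T F).mulVec
      (fun m => ∏ j, x j ^ (m : σ →₀ ℕ) j) = 0 := by
    ext m
    set G : MvPolynomial σ k :=
      monomial ((m : σ →₀ ℕ) - Finsupp.single (pivot D (m : σ →₀ ℕ)) D) 1 *
        F (pivot D (m : σ →₀ ℕ)) with hGdef
    have hpiv := le_pivot hT (m : σ →₀ ℕ) (sum_eq_of_mem_finsuppAntidiag m)
    have hG : G.IsHomogeneous T := by
      have h1 : (monomial ((m : σ →₀ ℕ) - Finsupp.single (pivot D (m : σ →₀ ℕ)) D)
          (1 : k)).IsHomogeneous (T - D) := by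
        refine isHomogeneous_monomial _ ?_
        have hsub : (m : σ →₀ ℕ) - Finsupp.single (pivot D (m : σ →₀ ℕ)) D +
            Finsupp.single (pivot D (m : σ →₀ ℕ)) D = m :=
          tsub_add_cancel_of_le (by simpa using hpiv)
        have hdeg := congrArg Finsupp.degree hsub
        rw [map_add, Finsupp.degree_single, Finsupp.degree_eq_sum (m : σ →₀ ℕ),
          sum_eq_of_mem_finsuppAntidiag m] at hdeg
        omega
      have h2 := h1.mul (hF (pivot D (m : σ →₀ ℕ)))
      have hDT : D ≤ T := by
        rw [← sum_eq_of_mem_finsuppAntidiag m]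
        exact hpiv.trans (Finset.single_le_sum (f := fun j => (m : σ →₀ ℕ) j)
          (fun _ _ => Nat.zero_le _) (Finset.mem_univ _))
      rwa [Nat.sub_add_cancel hDT] at h2
    have hev : eval x G = 0 := by rw [hGdef, map_mul, hx, mul_zero]
    rw [eval_eq'] at hev
    rw [Pi.zero_apply, ← hev]
    refine (Finset.sum_coe_sort (Finset.univ.finsuppAntidiag T)
      (fun m' => coeff m' G * ∏ j, x j ^ m' j)).trans ?_
    refine (Finset.sum_subset (fun m' hm' => ?_) fun m' _ hm' => ?_).symm
    · refine Finset.mem_finsuppAntidiag.2 ⟨?_, Finset.subset_univ _⟩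
      rw [← Finsupp.degree_eq_sum, Finsupp.degree_eq_weight_one]
      exact hG (mem_support_iff.1 hm')
    · rw [notMem_support_iff.1 hm', zero_mul]
  have hvec := Matrix.eq_zero_of_mulVec_eq_zero hdet hker
  ext j
  have hmem : Finsupp.single j T ∈ (Finset.univ : Finset σ).finsuppAntidiag T := by
    refine Finset.mem_finsuppAntidiag.2 ⟨?_, Finset.subset_univ _⟩
    rw [← Finsupp.degree_eq_sum, Finsupp.degree_single]
  have h := congrFun hvec ⟨_, hmem⟩
  rw [Finset.prod_eq_single j (by
    intro i _ hi
    simp [hi.symm]) (by simp)] at h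
  simp only [Finsupp.single_eq_same, Pi.zero_apply] at h
  exact pow_eq_zero_iff (by omega) |>.1 h

/-- Multiplying back by the pivot power restores the monomial indexing the row, so the matrix is
scalar. -/
theorem det_eliminationMatrix_pow_ne_zero {σ k : Type*} [Fintype σ] [DecidableEq σ]
    [Nonempty σ] [Field k] {D T : ℕ} (hT : Fintype.card σ * D < T) (c : k) (hc : c ≠ 0) :
    (eliminationMatrix D T fun j : σ => C c * X j ^ D).det ≠ 0 := by
  have : eliminationMatrix D T (fun j : σ => C c * X j ^ D) =
      Matrix.diagonal fun _ => c := by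
    ext m m'
    have hpiv := le_pivot hT (m : σ →₀ ℕ) (sum_eq_of_mem_finsuppAntidiag m)
    have hsub : (m : σ →₀ ℕ) - Finsupp.single (pivot D (m : σ →₀ ℕ)) D +
        Finsupp.single (pivot D (m : σ →₀ ℕ)) D = m :=
      tsub_add_cancel_of_le (by simpa using hpiv)
    rw [eliminationMatrix, Matrix.of_apply, X_pow_eq_monomial, C_mul_monomial, monomial_mul, hsub,
      coeff_monomial, Matrix.diagonal_apply]
    simp only [Subtype.ext_iff, mul_one, one_mul]
  rw [this, Matrix.det_diagonal]
  exact Finset.prod_ne_zero_iff.2 fun _ _ => hc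

/-! ### Polynomial functions and the topology on forms -/

theorem linear_mem_polynomialFunctions {k V : Type*} [Field k] [AddCommGroup V] [Module k V]
    (φ : V →ₗ[k] k) : (fun v => φ v) ∈ polynomialFunctions k V :=
  Algebra.subset_adjoin ⟨φ, rfl⟩

theorem comp_linear_mem_polynomialFunctions {k V W : Type*} [Field k] [AddCommGroup V] [Module k V]
    [AddCommGroup W] [Module k W] (L : W →ₗ[k] V) {p : V → k} (hp : p ∈ polynomialFunctions k V) :
    (fun w => p (L w)) ∈ polynomialFunctions k W := by
  induction hp using Algebra.adjoin_induction with
  | mem p hp =>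
    obtain ⟨φ, rfl⟩ := hp
    exact linear_mem_polynomialFunctions (φ.comp L)
  | algebraMap r => exact (polynomialFunctions k W).algebraMap_mem r
  | add p q _ _ hp hq => exact add_mem hp hq
  | mul p q _ _ hp hq => exact mul_mem hp hq

theorem exists_polynomial_of_mem_polynomialFunctions {k V : Type*} [Field k] [AddCommGroup V]
    [Module k V] {p : V → k} (hp : p ∈ polynomialFunctions k V) (A B C : V) :
    ∃ q : Polynomial k, ∀ t : k, p (A + t • B + t ^ 2 • C) = q.eval t := by
  induction hp using Algebra.adjoin_induction with
  | mem p hp =>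
    obtain ⟨φ, rfl⟩ := hp
    refine ⟨Polynomial.C (φ A) + Polynomial.X * Polynomial.C (φ B) +
      Polynomial.X ^ 2 * Polynomial.C (φ C), fun t => ?_⟩
    simp
    ring
  | algebraMap r => exact ⟨Polynomial.C r, fun t => by simp [Pi.algebraMap_apply]⟩
  | add p q _ _ hp hq =>
    obtain ⟨a, ha⟩ := hp
    obtain ⟨b, hb⟩ := hq
    exact ⟨a + b, fun t => by simp [ha, hb]⟩
  | mul p q _ _ hp hq =>
    obtain ⟨a, ha⟩ := hp
    obtain ⟨b, hb⟩ := hq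
    exact ⟨a * b, fun t => by simp [ha, hb]⟩

theorem det_mem_polynomialFunctions {k V n : Type*} [Field k] [AddCommGroup V] [Module k V]
    [Fintype n] [DecidableEq n] (A : V → Matrix n n k)
    (hA : ∀ i j, (fun v => A v i j) ∈ polynomialFunctions k V) :
    (fun v => (A v).det) ∈ polynomialFunctions k V := by
  have : (fun v => (A v).det) = ∑ τ : Equiv.Perm n, ((Equiv.Perm.sign τ : ℤˣ) : ℤ) •
      ∏ i, fun v => A v (τ i) i := by
    ext v
    simp [Matrix.det_apply', Finset.sum_apply, Finset.prod_apply]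
  rw [this]
  exact sum_mem fun τ _ => zsmul_mem (prod_mem fun i _ => hA _ _) _

/-- The coefficients of `F v` are polynomial functions of `v`. -/
def IsPolynomialMap {k V σ : Type*} [Field k] [AddCommGroup V] [Module k V]
    (F : V → MvPolynomial σ k) : Prop :=
  ∀ m, (fun v => coeff m (F v)) ∈ polynomialFunctions k V

namespace IsPolynomialMap

variable {k V σ : Type*} [Field k] [AddCommGroup V] [Module k V]

theorem of_linear (L : V →ₗ[k] MvPolynomial σ k) : IsPolynomialMap fun v => L v :=
  fun m => linear_mem_polynomialFunctions ((lcoeff k m).comp L)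

theorem const (p : MvPolynomial σ k) : IsPolynomialMap fun _ : V => p :=
  fun m => (polynomialFunctions k V).algebraMap_mem (coeff m p)

theorem mul {F G : V → MvPolynomial σ k} (hF : IsPolynomialMap F) (hG : IsPolynomialMap G) :
    IsPolynomialMap fun v => F v * G v := by
  classical
  intro m
  have : (fun v => coeff m (F v * G v)) = ∑ x ∈ Finset.HasAntidiagonal.antidiagonal m,
      (fun v => coeff x.1 (F v)) * fun v => coeff x.2 (G v) := by
    ext v
    simp [coeff_mul, Finset.sum_apply]
  rw [this]
  exact sum_mem fun x _ => mul_mem (hF _) (hG _)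

theorem sum {ι : Type*} (s : Finset ι) {F : ι → V → MvPolynomial σ k}
    (hF : ∀ i ∈ s, IsPolynomialMap (F i)) : IsPolynomialMap fun v => ∑ i ∈ s, F i v := by
  intro m
  have : (fun v => coeff m (∑ i ∈ s, F i v)) = ∑ i ∈ s, fun v => coeff m (F i v) := by
    ext v
    simp [coeff_sum, Finset.sum_apply]
  rw [this]
  exact sum_mem fun i hi => hF i hi m

theorem prod {ι : Type*} (s : Finset ι) {F : ι → V → MvPolynomial σ k}
    (hF : ∀ i ∈ s, IsPolynomialMap (F i)) : IsPolynomialMap fun v => ∏ i ∈ s, F i v := by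
  classical
  induction s using Finset.induction_on with
  | empty => simpa using const 1
  | insert a s ha ih =>
    simp only [Finset.prod_insert ha]
    exact (hF a (Finset.mem_insert_self a s)).mul
      (ih fun i hi => hF i (Finset.mem_insert_of_mem hi))

theorem det {n : Type*} [Fintype n] [DecidableEq n] {A : V → Matrix n n (MvPolynomial σ k)}
    (hA : ∀ i j, IsPolynomialMap fun v => A v i j) : IsPolynomialMap fun v => (A v).det := by
  simp only [Matrix.det_apply']
  exact sum _ fun τ _ => (const _).mul (prod _ fun i _ => hA _ _)

end IsPolynomialMap

/-- `finiteFormsInclusion` as a linear map. -/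
noncomputable def finiteFormsInclusionLinear (k : Type*) [Field k] (n d : ℕ) :
    FiniteForms k n d →ₗ[k] Forms k d where
  toFun := finiteFormsInclusion k n d
  map_add' f g := Subtype.ext (by simp [finiteFormsInclusion])
  map_smul' c f := Subtype.ext (by simp [finiteFormsInclusion])

theorem isOpen_ne_zero {k : Type*} [Field k] {d : ℕ} {P : Forms k d → k}
    (hP : P ∈ polynomialFunctions k (Forms k d)) : IsOpen {f | P f ≠ 0} := by
  refine isOpen_iSup_iff.2 fun n => isOpen_coinduced.2 ?_
  refine ⟨{fun f => P (finiteFormsInclusionLinear k n d f)}, ?_, ?_⟩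
  · rintro _ rfl
    exact comp_linear_mem_polynomialFunctions _ hP
  · ext f
    simp [finiteFormsInclusionLinear]

theorem exists_polynomialFunction_of_isOpen {k : Type*} [Field k] {d : ℕ} {O : Set (Forms k d)}
    (hO : IsOpen O) (n : ℕ) {f : FiniteForms k n d} (hf : finiteFormsInclusion k n d f ∈ O) :
    ∃ p ∈ polynomialFunctions k (FiniteForms k n d), p f ≠ 0 ∧
      ∀ g, p g ≠ 0 → finiteFormsInclusion k n d g ∈ O := by
  obtain ⟨I, hI, hOI⟩ := isOpen_coinduced.1 (isOpen_iSup_iff.1 hO n)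
  have hmem : ∀ g, finiteFormsInclusion k n d g ∈ O ↔ ∃ p ∈ I, p g ≠ 0 := by
    intro g
    have := Set.ext_iff.1 hOI g
    simp only [Set.mem_compl_iff, Set.mem_preimage, Set.mem_ofPred_eq] at this
    rw [← not_iff_not, this]
    simp
  obtain ⟨p, hp, hpf⟩ := (hmem f).1 hf
  exact ⟨p, hI hp, hpf, fun g hg => (hmem g).2 ⟨p, hp, hg⟩⟩

theorem exists_finiteForms (k : Type*) [Field k] {d : ℕ} (f : Forms k d) :
    ∃ n₀, ∀ n, n₀ ≤ n → f ∈ Set.range (finiteFormsInclusion k n d) := by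
  refine ⟨(f : MvPolynomial ℕ k).vars.sup id, fun n hn => ?_⟩
  obtain ⟨q, hq⟩ := exists_rename_eq_of_vars_subset_range (f : MvPolynomial ℕ k)
    (Fin.val : Fin (n + 1) → ℕ) Fin.val_injective fun i hi =>
      ⟨⟨i, Nat.lt_succ_of_le ((Finset.le_sup (f := id) hi).trans hn)⟩, rfl⟩
  have hf := (mem_homogeneousSubmodule _ _).1 f.2
  rw [← hq, IsHomogeneous.rename_isHomogeneous_iff Fin.val_injective] at hf
  exact ⟨⟨q, hf⟩, Subtype.ext hq⟩

/-- Any two elements of a stratum lie on a curve parametrized by the affine line, so the nonvanishing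
locus of a polynomial function is dense in the stratum unless it is empty. -/
theorem dense_of_polynomial_ne_zero {k : Type*} [Field k] [Infinite k] {d s : ℕ}
    (μ : Fin (s + 1) → ℕ) {P : Forms k d → k} (hP : P ∈ polynomialFunctions k (Forms k d))
    (hdμ : ∀ i, μ i ≤ d)
    {f₀ : Forms k d} (hf₀ : f₀ ∈ strengthStratum k d μ) (hPf₀ : P f₀ ≠ 0) :
    Dense {f : ↥(strengthStratum k d μ) | P f ≠ 0} := by
  rw [dense_iff_inter_open]
  rintro V hV ⟨⟨f₁, hf₁⟩, hf₁V⟩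
  obtain ⟨O, hO, rfl⟩ := isOpen_induced_iff.1 hV
  obtain ⟨g, h, hg, hh, hf₀e⟩ := hf₀
  obtain ⟨g', h', hg', hh', hf₁e⟩ := hf₁
  have hdeg : ∀ {a b : MvPolynomial ℕ k} {i}, a.IsHomogeneous (μ i) → b.IsHomogeneous (d - μ i) →
      (a * b).IsHomogeneous d := by
    intro a b i ha hb
    have := ha.mul hb
    rwa [Nat.add_sub_cancel' (hdμ i)] at this
  -- `B` and `C` are the coefficients of `t` and `t ^ 2` when both factors of each product move
  -- linearly from the decomposition of `f₀` to that of `f₁`.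
  let B : Forms k d := ⟨∑ i, (g i * (h' i - h i) + (g' i - g i) * h i),
    IsHomogeneous.sum _ _ _ fun i _ => (hdeg (hg i) ((hh' i).sub (hh i))).add
      (hdeg ((hg' i).sub (hg i)) (hh i))⟩
  let C : Forms k d := ⟨∑ i, (g' i - g i) * (h' i - h i),
    IsHomogeneous.sum _ _ _ fun i _ => hdeg ((hg' i).sub (hg i)) ((hh' i).sub (hh i))⟩
  have hcurve : ∀ t : k, f₀ + t • B + t ^ 2 • C ∈ strengthStratum k d μ := by
    intro t
    refine ⟨fun i => g i + t • (g' i - g i), fun i => h i + t • (h' i - h i), fun i => ?_,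
      fun i => ?_, ?_⟩
    · exact (hg i).add ((homogeneousSubmodule ℕ k _).smul_mem t ((hg' i).sub (hg i)))
    · exact (hh i).add ((homogeneousSubmodule ℕ k _).smul_mem t ((hh' i).sub (hh i)))
    · simp only [Submodule.coe_add, Submodule.coe_smul, hf₀e, B, C, Finset.smul_sum,
        ← Finset.sum_add_distrib]
      refine Finset.sum_congr rfl fun i _ => ?_
      simp only [MvPolynomial.smul_eq_C_mul, map_pow]
      ring
  have hone : f₀ + (1 : k) • B + (1 : k) ^ 2 • C = f₁ := by
    apply Subtype.ext
    simp only [Submodule.coe_add, hf₀e, hf₁e, B, C, one_smul, one_pow,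
      ← Finset.sum_add_distrib]
    exact Finset.sum_congr rfl fun i _ => by ring
  obtain ⟨q, hq⟩ := exists_polynomial_of_mem_polynomialFunctions hP f₀ B C
  -- Openness is tested at finite levels, so the whole curve is placed in one polynomial ring in
  -- finitely many variables.
  obtain ⟨a, ha⟩ := exists_finiteForms k f₀
  obtain ⟨b, hb⟩ := exists_finiteForms k B
  obtain ⟨c, hc⟩ := exists_finiteForms k C
  obtain ⟨A', hA'⟩ := ha (a + b + c) (by omega)
  obtain ⟨B', hB'⟩ := hb (a + b + c) (by omega)
  obtain ⟨C', hC'⟩ := hc (a + b + c) (by omega)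
  have hincl : ∀ t : k, finiteFormsInclusion k (a + b + c) d (A' + t • B' + t ^ 2 • C') =
      f₀ + t • B + t ^ 2 • C := by
    intro t
    rw [← hA', ← hB', ← hC']
    change finiteFormsInclusionLinear k (a + b + c) d _ = finiteFormsInclusionLinear k _ d _ +
      t • finiteFormsInclusionLinear k _ d _ + t ^ 2 • finiteFormsInclusionLinear k _ d _
    simp only [map_add, map_smul]
  obtain ⟨p, hp, hp1, hpO⟩ := exists_polynomialFunction_of_isOpen hO (a + b + c)
    (f := A' + (1 : k) • B' + (1 : k) ^ 2 • C') (by rw [hincl, hone]; exact hf₁V)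
  obtain ⟨r, hr⟩ := exists_polynomial_of_mem_polynomialFunctions hp A' B' C'
  -- `q` is nonzero at `t = 0`, the end `f₀`, and `r` at `t = 1`, the end `f₁`; over an infinite
  -- field some `t` serves both.
  have hqr : q * r ≠ 0 := by
    refine mul_ne_zero ?_ ?_
    · rintro rfl
      exact hPf₀ (by simpa using hq 0)
    · rintro rfl
      exact hp1 (by simpa using hr 1)
  obtain ⟨t, ht⟩ : ∃ t, (q * r).eval t ≠ 0 := by
    by_contra! h0
    exact hqr (Polynomial.funext (by simpa using h0))
  rw [Polynomial.eval_mul, ← hq, ← hr] at ht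
  refine ⟨⟨_, hcurve t⟩, ?_, left_ne_zero_of_mul ht⟩
  change f₀ + t • B + t ^ 2 • C ∈ O
  rw [← hincl]
  exact hpO _ (right_ne_zero_of_mul ht)

/-! ### The second derivatives along a coordinate subspace -/

/-- Pairwise distinct variables `x_j` and `y_{a,j}` among the `z_0, z_1, …`. -/
def varCode (m M : ℕ) : Fin M ⊕ ((Fin m ⊕ Fin m) × Fin M) → ℕ := Encodable.encode

theorem varCode_injective (m M : ℕ) : Function.Injective (varCode m M) :=
  Encodable.encode_injective

/-- The restriction to the coordinate subspace where all variables except the `x_j` vanish. -/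
noncomputable def restrictVars (k : Type*) [Field k] (m M : ℕ) :
    MvPolynomial ℕ k →ₐ[k] MvPolynomial (Fin M) k :=
  aeval (Function.extend (fun j => varCode m M (Sum.inl j)) X 0)

theorem restrictVars_X_inl (k : Type*) [Field k] (m M : ℕ) (j : Fin M) :
    restrictVars k m M (X (varCode m M (Sum.inl j))) = X j := by
  rw [restrictVars, aeval_X]
  exact ((varCode_injective m M).comp Sum.inl_injective).extend_apply _ _ _

theorem restrictVars_X_inr (k : Type*) [Field k] (m M : ℕ) (a : (Fin m ⊕ Fin m) × Fin M) :
    restrictVars k m M (X (varCode m M (Sum.inr a))) = 0 := by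
  rw [restrictVars, aeval_X, Function.extend_apply', Pi.zero_apply]
  rintro ⟨j, hj⟩
  simpa using varCode_injective m M hj

theorem isHomogeneous_restrictVars {k : Type*} [Field k] (m M : ℕ) {f : MvPolynomial ℕ k} {n : ℕ}
    (hf : f.IsHomogeneous n) : (restrictVars k m M f).IsHomogeneous n := by
  have := hf.aeval (S := k) (n := 1)
    (Function.extend (fun j => varCode m M (Sum.inl j)) X 0) (fun t => by
      by_cases h : ∃ j, varCode m M (Sum.inl j) = t
      · obtain ⟨j, rfl⟩ := h
        have := ((varCode_injective m M).comp Sum.inl_injective).extend_apply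
          (X : Fin M → MvPolynomial (Fin M) k) 0 j
        exact this.symm ▸ isHomogeneous_X k j
      · rw [Function.extend_apply' _ _ _ h]
        exact isHomogeneous_zero _ _ _)
  rwa [one_mul] at this

/-- The determinant of the second derivatives of `f` in the directions `y_{a,j}`, as a polynomial
on the coordinate subspace of the `x_j`. -/
noncomputable def hessianDet {k : Type*} [Field k] (m M : ℕ) (j : Fin M) (f : MvPolynomial ℕ k) :
    MvPolynomial (Fin M) k :=
  (Matrix.of fun a b : Fin m ⊕ Fin m => restrictVars k m M
    (pderiv (varCode m M (Sum.inr (a, j))) (pderiv (varCode m M (Sum.inr (b, j))) f))).det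

theorem isHomogeneous_hessianDet {k : Type*} [Field k] (m M : ℕ) (j : Fin M)
    {f : MvPolynomial ℕ k} {d : ℕ} (hf : f.IsHomogeneous d) :
    (hessianDet m M j f).IsHomogeneous (2 * m * (d - 2)) := by
  rw [hessianDet, Matrix.det_apply]
  refine IsHomogeneous.sum _ _ _ fun τ _ => ?_
  have hprod : (∏ i, (Matrix.of fun a b : Fin m ⊕ Fin m => restrictVars k m M
      (pderiv (varCode m M (Sum.inr (a, j)))
        (pderiv (varCode m M (Sum.inr (b, j))) f))) (τ i) i).IsHomogeneous
      (2 * m * (d - 2)) := by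
    have := IsHomogeneous.prod Finset.univ (fun i => (Matrix.of fun a b : Fin m ⊕ Fin m =>
      restrictVars k m M (pderiv (varCode m M (Sum.inr (a, j)))
        (pderiv (varCode m M (Sum.inr (b, j))) f))) (τ i) i) (fun _ => d - 1 - 1)
      fun i _ => isHomogeneous_restrictVars m M hf.pderiv.pderiv
    convert this using 1
    simp only [Finset.sum_const, Finset.card_univ, Fintype.card_sum, Fintype.card_fin, smul_eq_mul,
      Nat.sub_sub, two_mul]
  rcases Int.units_eq_one_or (Equiv.Perm.sign τ) with h | h <;> rw [h]
  · rwa [one_smul]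
  · rw [Units.neg_smul, one_smul]
    exact hprod.neg

theorem isPolynomialMap_hessianDet (k : Type*) [Field k] (d m M : ℕ) (j : Fin M) :
    IsPolynomialMap fun f : Forms k d => hessianDet m M j (f : MvPolynomial ℕ k) :=
  IsPolynomialMap.det fun a b => IsPolynomialMap.of_linear
    ((restrictVars k m M).toLinearMap ∘ₗ
      ((pderiv (varCode m M (Sum.inr (a, j)))).toLinearMap ∘ₗ
        (pderiv (varCode m M (Sum.inr (b, j)))).toLinearMap) ∘ₗ Submodule.subtype _)

/-- The polynomial function on forms of degree `d` whose nonvanishing forces some `hessianDet` to be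
nonzero at every nonzero point of the coordinate subspace. -/
noncomputable def discriminant (k : Type*) [Field k] (d m M : ℕ) (f : Forms k d) : k :=
  (eliminationMatrix (2 * m * (d - 2)) ((M + 1) * (2 * m * (d - 2)) + 1)
    fun j : Fin (M + 1) => hessianDet m (M + 1) j (f : MvPolynomial ℕ k)).det

theorem discriminant_mem_polynomialFunctions (k : Type*) [Field k] (d m M : ℕ) :
    discriminant k d m M ∈ polynomialFunctions k (Forms k d) :=
  det_mem_polynomialFunctions _ fun _ _ =>
    ((IsPolynomialMap.const _).mul (isPolynomialMap_hessianDet k d m (M + 1) _)) _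

theorem eq_zero_of_discriminant_ne_zero {k : Type*} [Field k] {d m M : ℕ} {f : Forms k d}
    (hf : discriminant k d m M f ≠ 0) (x : Fin (M + 1) → k)
    (hx : ∀ j, eval x (hessianDet m (M + 1) j (f : MvPolynomial ℕ k)) = 0) : x = 0 :=
  eq_zero_of_det_eliminationMatrix_ne_zero (by simp) _
    (fun j => isHomogeneous_hessianDet m _ j ((mem_homogeneousSubmodule _ _).1 f.2)) hf x hx

/-! ### A form with nonzero discriminant -/

/-- The form `∑ j, x_j ^ (e - 1) * y_{i,j}`. -/
noncomputable def genericFactor (k : Type*) [Field k] (m M e : ℕ) (i : Fin m ⊕ Fin m) :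
    MvPolynomial ℕ k :=
  ∑ j : Fin M, X (varCode m M (Sum.inl j)) ^ (e - 1) * X (varCode m M (Sum.inr (i, j)))

theorem isHomogeneous_genericFactor (k : Type*) [Field k] (m M : ℕ) {e : ℕ} (he : 1 ≤ e)
    (i : Fin m ⊕ Fin m) : (genericFactor k m M e i).IsHomogeneous e := by
  refine IsHomogeneous.sum _ _ _ fun j _ => ?_
  have := (isHomogeneous_X_pow (R := k) (varCode m M (Sum.inl j)) (e - 1)).mul
    (isHomogeneous_X k (varCode m M (Sum.inr (i, j))))
  rwa [Nat.sub_add_cancel he] at this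

theorem restrictVars_genericFactor (k : Type*) [Field k] (m M e : ℕ) (i : Fin m ⊕ Fin m) :
    restrictVars k m M (genericFactor k m M e i) = 0 := by
  simp [genericFactor, restrictVars_X_inr]

theorem restrictVars_pderiv_genericFactor (k : Type*) [Field k] (m M e : ℕ)
    (i a : Fin m ⊕ Fin m) (j : Fin M) :
    restrictVars k m M (pderiv (varCode m M (Sum.inr (a, j))) (genericFactor k m M e i)) =
      if i = a then X j ^ (e - 1) else 0 := by
  classical
  -- The powers of `x_j` are constants for the `y` directions, so no exponent appears as a
  -- coefficient that could vanish in positive characteristic.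
  have hinl : ∀ j', pderiv (varCode m M (Sum.inr (a, j)))
      (X (varCode m M (Sum.inl j')) : MvPolynomial ℕ k) = 0 := fun j' =>
    pderiv_X_of_ne fun h => by simpa using varCode_injective m M h
  simp only [genericFactor, map_sum, Derivation.leibniz, Derivation.leibniz_pow, hinl,
    smul_eq_mul, pderiv_X, Pi.single_apply,
    (varCode_injective m M).eq_iff, Sum.inr.injEq, Prod.mk.injEq]
  by_cases h : i = a
  · subst h
    simp [eq_comm, apply_ite (restrictVars k m M), restrictVars_X_inl]
  · simp [h, eq_comm]

/-- In the directions `y_{·,j}` the Jacobian of the generic factors is diagonal with powers of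
`x_j`. So each `hessianDet` is a signed power of its own variable, and the elimination matrix is
scalar. -/
theorem discriminant_ne_zero {k : Type*} [Field k] {d m M : ℕ} (e : Fin m ⊕ Fin m → ℕ)
    (he : ∀ i, 1 ≤ e i) (hed : ∀ i, e (Sum.inl i) + e (Sum.inr i) = d) (f : Forms k d)
    (hf : (f : MvPolynomial ℕ k) = ∑ i, genericFactor k m (M + 1) (e (Sum.inl i)) (Sum.inl i) *
      genericFactor k m (M + 1) (e (Sum.inr i)) (Sum.inr i)) :
    discriminant k d m M f ≠ 0 := by
  have hsum : (∑ i, (e i - 1)) * 2 = 2 * m * (d - 2) := by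
    have : ∀ i, (e (Sum.inl i) - 1) + (e (Sum.inr i) - 1) = d - 2 := by
      intro i
      have := hed i
      have := he (Sum.inl i)
      have := he (Sum.inr i)
      omega
    rw [Fintype.sum_sum_type, ← Finset.sum_add_distrib, Finset.sum_congr rfl fun i _ => this i]
    simp only [Finset.sum_const, Finset.card_univ, Fintype.card_fin, smul_eq_mul]
    ring
  have hdet : (fun j : Fin (M + 1) => hessianDet m (M + 1) j (f : MvPolynomial ℕ k)) =
      fun j => C (((Equiv.Perm.sign (Equiv.sumComm (Fin m) (Fin m)) : ℤˣ) : ℤ) : k) *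
        X j ^ (2 * m * (d - 2)) := by
    funext j
    have key := det_hessian (restrictVars k m (M + 1) : MvPolynomial ℕ k →+* MvPolynomial (Fin (M + 1)) k)
      (fun i => genericFactor k m (M + 1) (e i) i)
      (fun i => restrictVars_genericFactor k m (M + 1) (e i) i)
      (fun a => varCode m (M + 1) (Sum.inr (a, j)))
    simp only [RingHom.coe_coe, restrictVars_pderiv_genericFactor] at key
    have hdiag : (Matrix.of fun i a : Fin m ⊕ Fin m =>
        if i = a then (X j : MvPolynomial (Fin (M + 1)) k) ^ (e i - 1) else 0) =
        Matrix.diagonal fun i => X j ^ (e i - 1) := by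
      ext1 i a
      rw [Matrix.of_apply, Matrix.diagonal_apply]
    rw [hdiag, Matrix.det_diagonal, Finset.prod_pow_eq_pow_sum, ← pow_mul, hsum] at key
    rw [hessianDet, hf, key, map_intCast]
  rw [discriminant, hdet]
  refine det_eliminationMatrix_pow_ne_zero (by simp) _ ?_
  rcases Int.units_eq_one_or (Equiv.Perm.sign (Equiv.sumComm (Fin m) (Fin m))) with h | h <;>
    simp [h]

/-! ### Decompositions of forms with nonzero discriminant -/

/-- The forms `p`, `u`, `v` number `2m + 2n < M + 1`, so they share a nonzero zero on the coordinate
subspace. A relation would make every `hessianDet` vanish there. -/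
theorem not_linear_combination_of_discriminant_ne_zero {k : Type*} [Field k] [IsAlgClosed k]
    {d m M n : ℕ} (hM : 2 * m + 2 * n ≤ M) {f : Forms k d} (hf : discriminant k d m M f ≠ 0)
    (p : Fin m ⊕ Fin m → MvPolynomial ℕ k) (hp : ∀ i, ∃ e, 1 ≤ e ∧ (p i).IsHomogeneous e)
    (hfp : (f : MvPolynomial ℕ k) = ∑ i, p (Sum.inl i) * p (Sum.inr i))
    (c : Fin m ⊕ Fin m → k) (hc : c ≠ 0) (u v : Fin n → MvPolynomial ℕ k)
    (hu : ∀ i, ∃ e, 1 ≤ e ∧ (u i).IsHomogeneous e)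
    (hv : ∀ i, ∃ e, 1 ≤ e ∧ (v i).IsHomogeneous e) : ∑ i, c i • p i ≠ ∑ i, u i * v i := by
  intro heq
  have hall : ∀ i, ∃ e, 1 ≤ e ∧ (Sum.elim p (Sum.elim u v) i).IsHomogeneous e := by
    rintro (i | i | i)
    exacts [hp i, hu i, hv i]
  obtain ⟨x, hx0, hx⟩ := exists_nonzero_common_zero (M := M + 1)
    (ι := (Fin m ⊕ Fin m) ⊕ (Fin n ⊕ Fin n))
    (by simp only [Fintype.card_sum, Fintype.card_fin]; omega)
    (fun i => restrictVars k m (M + 1) (Sum.elim p (Sum.elim u v) i)) (fun i => by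
      obtain ⟨e, he, hhom⟩ := hall i
      rw [eval_zero, constantCoeff_eq]
      -- Positive degree is what makes the forms vanish at the origin.
      exact (isHomogeneous_restrictVars m (M + 1) hhom).coeff_eq_zero (by simp; omega))
  refine hx0 (eq_zero_of_discriminant_ne_zero hf x fun j => ?_)
  have := det_hessian_eq_zero ((aeval x).comp (restrictVars k m (M + 1))) p
    (fun i => hx (Sum.inl i)) c hc u v (fun i => hx (Sum.inr (Sum.inl i)))
    (fun i => hx (Sum.inr (Sum.inr i))) heq (fun a => varCode m (M + 1) (Sum.inr (a, j)))
  rw [hessianDet, RingHom.map_det, hfp, ← this]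
  rfl

theorem exists_decomposition_of_strength_eq {k : Type*} [Field k] {f : MvPolynomial ℕ k} {t : ℕ}
    (h : strength f = t) : ∃ g h : Fin (t + 1) → MvPolynomial ℕ k,
      IsStrengthDecomposition f g h := by
  by_contra hcon
  have : ((t + 1 : ℕ) : ℕ∞) ≤ strength f := by
    refine le_iInf₂ fun r hr => ?_
    have hle : strength f ≤ r := iInf₂_le r hr
    rw [h] at hle
    have hne : t ≠ r := by
      rintro rfl
      exact hcon hr
    have := Nat.cast_le.1 hle
    exact_mod_cast (by omega : t + 1 ≤ r)
  rw [h, Nat.cast_le] at this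
  omega

/-- A shorter decomposition, padded with zeros to `s + 1` terms, has a zero factor, which is itself
a forbidden linear relation (with `n = 0`). -/
theorem le_strength_of_discriminant_ne_zero {k : Type*} [Field k] [IsAlgClosed k] {d s M : ℕ}
    (hM : 2 * (s + 1) ≤ M) {f : Forms k d} (hf : discriminant k d (s + 1) M f ≠ 0) :
    (s : ℕ∞) ≤ strength (f : MvPolynomial ℕ k) := by
  refine le_iInf₂ fun t ⟨g, h, hg, hh, hfe⟩ => ?_
  by_contra! hlt
  have hts : t + 1 ≤ s := by exact_mod_cast hlt
  let pad : (Fin (t + 1) → MvPolynomial ℕ k) → Fin (s + 1) → MvPolynomial ℕ k :=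
    fun q i => if hi : (i : ℕ) ≤ t then q ⟨i, Nat.lt_succ_of_le hi⟩ else 0
  have hpad : ∀ q, (∀ i, ∃ e, 1 ≤ e ∧ (q i).IsHomogeneous e) →
      ∀ i, ∃ e, 1 ≤ e ∧ (pad q i).IsHomogeneous e := by
    intro q hq i
    by_cases hi : (i : ℕ) ≤ t
    · simpa [pad, hi] using hq ⟨i, Nat.lt_succ_of_le hi⟩
    · exact ⟨1, le_rfl, by simpa [pad, hi] using isHomogeneous_zero _ _ _⟩
  refine not_linear_combination_of_discriminant_ne_zero (n := 0) (by omega) hf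
    (Sum.elim (pad g) (pad h)) (by rintro (i | i); exacts [hpad g hg i, hpad h hh i]) ?_
    -- The last padded `g` is zero because `t < s`.
    (Pi.single (Sum.inl (Fin.last s)) 1) (by simp) Fin.elim0 Fin.elim0 (fun i => i.elim0)
    (fun i => i.elim0) ?_
  · rw [hfe]
    simp only [Sum.elim_inl, Sum.elim_inr]
    have hcast : ∀ q i, pad q (Fin.castLE (by omega) i) = q i :=
      fun q i => by simp [pad, Nat.le_of_lt_succ i.2]
    rw [← Finset.sum_subset (Finset.subset_univ
      (Finset.univ.map (Fin.castLEEmb (by omega : t + 1 ≤ s + 1))))]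
    · simp [Finset.sum_map, hcast]
    · intro i _ hi
      have : ¬ (i : ℕ) ≤ t := fun hlt =>
        hi (Finset.mem_map.2 ⟨⟨i, Nat.lt_succ_of_le hlt⟩, by simp⟩)
      simp [pad, this]
  · have : ¬ s ≤ t := by omega
    simp [Pi.single_apply, ite_smul, pad, this]

/-- A combination of strength `t < N` would be a sum of `t + 1 ≤ N` products, hence the term `2 * N`
in the bound on `M`. -/
theorem le_collectiveStrength_of_discriminant_ne_zero {k : Type*} [Field k] [IsAlgClosed k]
    {N d s M : ℕ} (hM : 2 * (s + 1) + 2 * N ≤ M) {f : Forms k d}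
    (hf : discriminant k d (s + 1) M f ≠ 0) (g h : Fin (s + 1) → MvPolynomial ℕ k)
    (hgh : IsStrengthDecomposition (f : MvPolynomial ℕ k) g h) :
    (N : ℕ∞) ≤ collectiveStrength (Sum.elim g h) := by
  obtain ⟨hg, hh, hfe⟩ := hgh
  refine le_iInf₂ fun c hc => le_iInf fun _ => le_iInf₂ fun t ⟨u, v, hu, hv, huv⟩ => ?_
  by_contra! hlt
  have htN : t < N := by exact_mod_cast hlt
  exact not_linear_combination_of_discriminant_ne_zero (by omega) hf (Sum.elim g h)
    (by rintro (i | i); exacts [hg i, hh i]) hfe c hc u v hu hv huv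

/-- The given decomposition bounds the strength above by `s`, so the strength is exactly `s` and
this decomposition competes in the supremum. -/
theorem le_secondaryStrength_of_discriminant_ne_zero {k : Type*} [Field k] [IsAlgClosed k]
    {N d s M : ℕ} (hM : 2 * (s + 1) + 2 * N ≤ M) {f : Forms k d}
    (hf : discriminant k d (s + 1) M f ≠ 0) (g h : Fin (s + 1) → MvPolynomial ℕ k)
    (hgh : IsStrengthDecomposition (f : MvPolynomial ℕ k) g h) :
    (N : ℕ∞) ≤ secondaryStrength (f : MvPolynomial ℕ k) := by
  have hs : strength (f : MvPolynomial ℕ k) = s :=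
    le_antisymm (iInf₂_le s ⟨g, h, hgh⟩) (le_strength_of_discriminant_ne_zero (by omega) hf)
  refine (le_collectiveStrength_of_discriminant_ne_zero hM hf g h hgh).trans ?_
  exact le_iSup₂_of_le s hs (le_iSup₂_of_le g h (le_iSup_of_le hgh le_rfl))

end StrengthTheory

/-! ### The dense open subset of the stratum -/

theorem mainTheorem3 {k : Type*} [Field k] [IsAlgClosed k] (N d s : ℕ) (hd : 2 ≤ d)
    (μ : Fin (s + 1) → ℕ) (hμ_mono : Monotone μ) (hμ_pos : ∀ i, 1 ≤ μ i)
    (hμ_le : ∀ i, μ i ≤ d / 2) :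
    ∃ U : Set ↥(StrengthTheory.strengthStratum k d μ), IsOpen U ∧ Dense U ∧
      ∀ f ∈ U, (N : ℕ∞) ≤
        StrengthTheory.secondaryStrength ((f : StrengthTheory.Forms k d) : MvPolynomial ℕ k) := by
  open StrengthTheory in
  have hle : ∀ i, μ i ≤ d := fun i => (hμ_le i).trans (Nat.div_le_self d 2)
  have hpos : ∀ i, 1 ≤ d - μ i := fun i => by
    have := hμ_le i
    omega
  let M := 2 * (s + 1) + 2 * N
  have hP := discriminant_mem_polynomialFunctions k d (s + 1) M
  let g : Fin (s + 1) → MvPolynomial ℕ k :=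
    fun i => genericFactor k (s + 1) (M + 1) (μ i) (Sum.inl i)
  let h : Fin (s + 1) → MvPolynomial ℕ k :=
    fun i => genericFactor k (s + 1) (M + 1) (d - μ i) (Sum.inr i)
  have hg : ∀ i, (g i).IsHomogeneous (μ i) := fun i =>
    isHomogeneous_genericFactor k _ _ (hμ_pos i) _
  have hh : ∀ i, (h i).IsHomogeneous (d - μ i) := fun i =>
    isHomogeneous_genericFactor k _ _ (hpos i) _
  -- The generic factors take the degrees prescribed by `μ`, so `f₀` lies in the stratum and
  -- witnesses that the discriminant is not identically zero on it.
  let f₀ : Forms k d := ⟨∑ i, g i * h i, MvPolynomial.IsHomogeneous.sum _ _ _ fun i _ => by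
    have := (hg i).mul (hh i)
    rwa [Nat.add_sub_cancel' (hle i)] at this⟩
  refine ⟨{f | discriminant k d (s + 1) M f ≠ 0}, (isOpen_ne_zero hP).preimage
    continuous_subtype_val, dense_of_polynomial_ne_zero μ hP hle (f₀ := f₀)
      ⟨g, h, hg, hh, rfl⟩ ?_, ?_⟩
  · refine discriminant_ne_zero (Sum.elim μ fun i => d - μ i) ?_
      (fun i => Nat.add_sub_cancel' (hle i)) f₀ rfl
    rintro (i | i)
    exacts [hμ_pos i, hpos i]
  · rintro ⟨f, g', h', hg', hh', hfe⟩ hf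
    exact le_secondaryStrength_of_discriminant_ne_zero le_rfl hf g' h'
      ⟨fun i => ⟨_, hμ_pos i, hg' i⟩, fun i => ⟨_, hpos i, hh' i⟩, hfe⟩
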